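/- Let $G$ be a finite simple connected bridgeless cubic graph. The \emph{oddness} of $G$ is the least number of cycles of odd length in a $2$-factor of $G$, taken over all $2$-factors of $G$ (spanning subgraphs in which every vertex has degree two). If $G$ has oddness four, then $G$ has an \emph{$S_4$-pair}: there exist two perfect matchings $M_1$ and $M_2$ of $G$ such that the graph $G \setminus (M_1 \cup M_2)$, obtained from $G$ by deleting all edges of $M_1 \cup M_2$, is bipartite. -/

import Mathlib

namespace SimpleGraph

variable {V : Type*}

/-- A graph is bridgeless if none of its edges is a bridge. -/
def IsBridgeless (G : SimpleGraph V) : Prop :=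
  ∀ e ∈ G.edgeSet, ¬ G.IsBridge e

/-- `F` is (the graph of) a 2-factor of `G`: a spanning subgraph of `G` in which every vertex
has degree two. -/
def IsTwoFactor (G F : SimpleGraph V) : Prop :=
  F ≤ G ∧ ∀ v : V, (F.neighborSet v).ncard = 2

/-- The oddness of `G`: the least number of odd cycles amongst all 2-factors of `G`.
The cycles of a 2-factor of a finite graph are its connected components, and the length of such a
cycle is its number of vertices, so the odd cycles are the components of odd cardinality. -/
noncomputable def oddness (G : SimpleGraph V) : ℕ :=
  sInf {n : ℕ | ∃ F : SimpleGraph V, G.IsTwoFactor F ∧ F.oddComponents.ncard = n}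

/-- Two perfect matchings form an `S₄`-pair if deleting (the edges of) their union leaves a
bipartite graph. -/
def IsS4Pair (G : SimpleGraph V) (M₁ M₂ : G.Subgraph) : Prop :=
  M₁.IsPerfectMatching ∧ M₂.IsPerfectMatching ∧
    (G.deleteEdges (M₁.edgeSet ∪ M₂.edgeSet)).IsBipartite

end SimpleGraph

/-! Take a 2-factor `F` with four odd cycles and let `M₁` be the complementary perfect matching,
given by the involution `m`. Deleting `M₁` leaves `F`, so it is enough that `M₂` contain an `F`-edge
of every odd cycle, that is, that it avoid some `M₁`-edge at each of them. The plan is to forbid one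
`M₁`-edge per odd cycle and to apply Tutte's theorem; `Q` is the set of ends of the forbidden edges.

If Tutte's condition fails, at least `s + 2` disjoint odd sets attach to only `s` vertices. Each is
left by at least three edges, by parity and bridgelessness, while at most `3s + |Q|` ends are
available, and at most `2s` of them belong to `F`. Hence two forbidden edges never obstruct, three
do so only with equality throughout, and four only if there is a full cut: an odd set left by
exactly three edges, all in `M₁`.

A full cut separates one odd cycle from the other three. For each odd cycle having such a cut,
choose a minimal one; uncrossing makes these disjoint. Contract them and forbid edges only at the
remaining odd cycles. With no cut there is no obstruction; with two or more, at most two edges are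
forbidden; with exactly one, the three edges are chosen so as to rule out the tight case. A second
use of the same count, with the outside of a minimal cut contracted, extends the matching into that
cut through whichever edge it enters (`exists_inner_matching`). -/

namespace SimpleGraph
-- Parity of cuts and the three-edge bound
section PartnerCuts
open scoped Classical
variable {V : Type*} [Fintype V]

/-- `F` is a 2-regular graph, `m` is a fixed-point free involution describing the perfect matching
complementary to `F` in `G`, and `G` is bridgeless. -/
structure IsFactorPair (G F : SimpleGraph V) (m : V → V) : Prop where
  invol : ∀ v, m (m v) = v
  adj_iff : ∀ v w, G.Adj v w ↔ F.Adj v w ∨ w = m v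
  not_adj : ∀ v, ¬ F.Adj v (m v)
  two : ∀ v, (Finset.univ.filter (F.Adj v)).card = 2
  bridgeless : G.IsBridgeless

/-- The darts of `F` leaving `X`. -/
noncomputable def leavingDarts (F : SimpleGraph V) (X : Finset V) : Finset (V × V) :=
  Finset.univ.filter fun p => p.1 ∈ X ∧ p.2 ∉ X ∧ F.Adj p.1 p.2

/-- The vertices of `X` whose partner is outside `X`. -/
noncomputable def leavingVerts (m : V → V) (X : Finset V) : Finset V :=
  Finset.univ.filter fun v => v ∈ X ∧ m v ∉ X

@[simp] lemma mem_leavingDarts {F : SimpleGraph V} {X : Finset V} {p : V × V} :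
    p ∈ leavingDarts F X ↔ p.1 ∈ X ∧ p.2 ∉ X ∧ F.Adj p.1 p.2 := by simp [leavingDarts]

@[simp] lemma mem_leavingVerts {m : V → V} {X : Finset V} {v : V} :
    v ∈ leavingVerts m X ↔ v ∈ X ∧ m v ∉ X := by simp [leavingVerts]

lemma even_card_of_involution {α : Type*} (s : Finset α) (g : α → α) (hg : ∀ a ∈ s, g a ∈ s)
    (hgg : ∀ a ∈ s, g (g a) = a) (hne : ∀ a ∈ s, g a ≠ a) : Even s.card := by
  have h : ∑ _a ∈ s, (1 : ZMod 2) = 0 :=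
    Finset.sum_involution (fun a _ => g a) (fun _ _ => by decide) (fun a ha _ => hne a ha)
      (fun a ha => hg a ha) (fun a ha => hgg a ha)
  rw [Finset.sum_const, nsmul_eq_mul, mul_one] at h
  exact (ZMod.natCast_eq_zero_iff_even).1 h

namespace IsFactorPair
variable {G F : SimpleGraph V} {m : V → V} (h : IsFactorPair G F m)
include h

lemma adj_partner (v : V) : G.Adj v (m v) := (h.adj_iff _ _).2 (Or.inr rfl)

lemma partner_ne (v : V) : m v ≠ v := (h.adj_partner v).ne'

lemma even_card_filter_partner_mem (X : Finset V) : Even (X.filter fun v => m v ∈ X).card := by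
  refine even_card_of_involution _ m ?_ (fun a _ => h.invol a) (fun a _ => h.partner_ne a)
  intro a ha
  simp only [Finset.mem_filter] at ha ⊢
  exact ⟨ha.2, by rw [h.invol]; exact ha.1⟩

lemma odd_card_iff (X : Finset V) : Odd X.card ↔ Odd (leavingVerts m X).card := by
  have h1 := h.even_card_filter_partner_mem X
  have h2 := Finset.card_filter_add_card_filter_not (s := X) (fun v => m v ∈ X)
  have h3 : X.filter (fun v => ¬ m v ∈ X) = leavingVerts m X := by ext; simp
  rw [h3] at h2
  rw [← h2]
  exact ⟨fun ho => by rcases h1 with ⟨a, ha⟩; rcases ho with ⟨b, hb⟩; exact ⟨b - a, by omega⟩,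
    fun ho => h1.add_odd ho⟩

/-- There are `2 * X.card` darts starting in `X`, and those that stay in `X` are paired by reversal.
-/
lemma even_card_leavingDarts (X : Finset V) : Even (leavingDarts F X).card := by
  have h1 : ((Finset.univ : Finset (V × V)).filter fun p => p.1 ∈ X ∧ F.Adj p.1 p.2).card
      = 2 * X.card := by
    rw [Finset.card_eq_sum_card_fiberwise (f := Prod.fst) (t := X)
      (fun p hp => by simp only [Finset.coe_filter, Set.mem_ofPred_eq] at hp; exact hp.2.1)]
    rw [Finset.sum_congr rfl (g := fun _ => 2), Finset.sum_const, smul_eq_mul, mul_comm]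
    intro v hv
    rw [← h.two v]
    refine Finset.card_nbij' (fun p => p.2) (fun w => (v, w)) ?_ ?_ ?_ ?_
    · rintro ⟨a, b⟩ hp
      simp only [Finset.coe_filter, Set.mem_ofPred_eq, Finset.mem_filter, Finset.mem_univ,
        true_and] at hp ⊢
      rw [← hp.2]; exact hp.1.2
    · intro w hw
      simp only [Finset.coe_filter, Set.mem_ofPred_eq, Finset.mem_filter, Finset.mem_univ,
        true_and] at hw ⊢
      exact ⟨⟨hv, hw⟩, trivial⟩
    · rintro ⟨a, b⟩ hp
      simp only [Finset.coe_filter, Set.mem_ofPred_eq, Finset.mem_filter, Finset.mem_univ,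
        true_and] at hp ⊢
      rw [← hp.2]
    · intro w _; rfl
  have h2 := Finset.card_filter_add_card_filter_not
    (s := (Finset.univ : Finset (V × V)).filter fun p => p.1 ∈ X ∧ F.Adj p.1 p.2)
    (fun p => p.2 ∈ X)
  have h3 : ((Finset.univ : Finset (V × V)).filter fun p => p.1 ∈ X ∧ F.Adj p.1 p.2).filter
      (fun p => ¬ p.2 ∈ X) = leavingDarts F X := by ext; simp; tauto
  rw [h3, h1] at h2
  have h4 : Even (((Finset.univ : Finset (V × V)).filter fun p => p.1 ∈ X ∧ F.Adj p.1 p.2).filter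
      (fun p => p.2 ∈ X)).card := by
    refine even_card_of_involution _ Prod.swap ?_ (fun a _ => Prod.swap_swap a) ?_
    · rintro ⟨a, b⟩ hp
      simp only [Finset.mem_filter, Finset.mem_univ, true_and, Prod.swap] at hp ⊢
      exact ⟨⟨hp.2, hp.1.2.symm⟩, hp.1.1⟩
    · rintro ⟨a, b⟩ hp he
      simp only [Finset.mem_filter, Finset.mem_univ, true_and, Prod.swap, Prod.mk.injEq] at hp he
      exact hp.1.2.ne he.2
  rcases h4 with ⟨a, ha⟩
  exact ⟨X.card - a, by omega⟩

lemma not_isolated_partner_edge (X : Finset V) (hF : (leavingDarts F X).card = 0)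
    (hm : (leavingVerts m X).card = 1) : False := by
  obtain ⟨v, hv⟩ := Finset.card_eq_one.1 hm
  have hv' : v ∈ X ∧ m v ∉ X := by rw [← mem_leavingVerts, hv]; simp
  refine h.bridgeless s(v, m v) (h.adj_partner v) ?_
  rw [isBridge_iff]
  rintro ⟨p⟩
  have key : ∀ (a b : V), (G.deleteEdges {s(v, m v)}).Walk a b → a ∈ X → b ∈ X := by
    intro a b q
    induction q with
    | nil => exact id
    | @cons a c b hac _ ih =>
      intro ha
      apply ih
      by_contra hc
      rw [deleteEdges_adj, h.adj_iff] at hac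
      rcases hac with ⟨hF' | rfl, hne⟩
      · have : (a, c) ∈ leavingDarts F X := mem_leavingDarts.2 ⟨ha, hc, hF'⟩
        rw [Finset.card_eq_zero.1 hF] at this
        simp at this
      · have : a ∈ leavingVerts m X := mem_leavingVerts.2 ⟨ha, hc⟩
        rw [hv, Finset.mem_singleton] at this
        subst this
        exact hne rfl
  exact hv'.2 (key _ _ p hv'.1)

/-- The first count is even and the second odd, so only a total of one has to be excluded, and that
would be a bridge. -/
lemma three_le_of_odd {X : Finset V} (hX : Odd X.card) :
    3 ≤ (leavingDarts F X).card + (leavingVerts m X).card := by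
  obtain ⟨a, ha⟩ := h.even_card_leavingDarts X
  obtain ⟨b, hb⟩ := (h.odd_card_iff X).1 hX
  by_contra hlt
  exact h.not_isolated_partner_edge X (by omega) (by omega)

end IsFactorPair

/-! ### Tutte's theorem and contraction -/

/-- Tutte's alternative for graphs of even order: either there is a perfect matching, or
there are at least `|S| + 2` pairwise disjoint odd sets with all outside neighbours in `S`. -/
lemma exists_isPerfectMatching_or_family {W : Type*} [Fintype W] (H : SimpleGraph W)
    (hW : Even (Fintype.card W)) :
    (∃ M : H.Subgraph, M.IsPerfectMatching) ∨ ∃ (S : Finset W) (𝒦 : Finset (Finset W)),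
      S.card + 2 ≤ 𝒦.card ∧ (∀ K ∈ 𝒦, Odd K.card ∧ ∀ a ∈ K, ∀ b ∉ K, H.Adj a b → b ∈ S) ∧
      (𝒦 : Set (Finset W)).PairwiseDisjoint id := by
  refine or_iff_not_imp_left.2 fun hno => ?_
  rw [tutte] at hno
  push Not at hno
  obtain ⟨u, hu⟩ := hno
  rw [IsTutteViolator] at hu
  set H' := ((⊤ : H.Subgraph).deleteVerts u).coe with hH'
  have hverts : ((⊤ : H.Subgraph).deleteVerts u).verts = uᶜ := by
    ext; simp
  have hpar := odd_ncard_oddComponents H'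
  have hcard : Nat.card ((⊤ : H.Subgraph).deleteVerts u).verts + u.ncard = Fintype.card W := by
    rw [hverts, Nat.card_coe_set_eq, add_comm, Set.ncard_add_ncard_compl, Nat.card_eq_fintype_card]
  let T : Finset H'.ConnectedComponent := Finset.univ.filter fun c => Odd c.supp.ncard
  have hT : H'.oddComponents.ncard = T.card := by
    rw [← Set.ncard_coe_finset]; congr 1; ext; simp [T]
  let f : H'.ConnectedComponent → Finset W := fun c =>
    Finset.univ.filter fun w => ∃ hw, H'.connectedComponentMk ⟨w, hw⟩ = c
  have hfmem : ∀ c w, w ∈ f c ↔ ∃ hw, H'.connectedComponentMk ⟨w, hw⟩ = c := by simp [f]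
  have hdisj : ∀ c d, ∀ w, w ∈ f c → w ∈ f d → c = d := by
    intro c d w hc hd
    rw [hfmem] at hc hd
    obtain ⟨_, rfl⟩ := hc
    obtain ⟨_, rfl⟩ := hd
    rfl
  have hfne : ∀ c, (f c).Nonempty := by
    intro c
    induction c using ConnectedComponent.ind with
    | h v => exact ⟨v.1, (hfmem _ _).2 ⟨v.2, rfl⟩⟩
  have hinj : Function.Injective f := by
    intro c d hcd
    obtain ⟨w, hw⟩ := hfne c
    exact hdisj c d w hw (hcd ▸ hw)
  refine ⟨u.toFinset, T.image f, ?_, ?_, ?_⟩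
  · rw [Finset.card_image_of_injective _ hinj, ← Set.ncard_eq_toFinset_card', ← hT]
    rw [← hT] at *
    -- Since the order is even, the number of odd components has the parity of `u`, so an excess of
    -- one is an excess of two.
    have h1 : Odd H'.oddComponents.ncard ↔ Odd u.ncard := by
      rw [hpar]
      rcases hW with ⟨k, hk⟩
      constructor
      · rintro ⟨l, hl⟩; exact ⟨k - l - 1, by omega⟩
      · rintro ⟨l, hl⟩; exact ⟨k - l - 1, by omega⟩
    rcases Nat.even_or_odd u.ncard with he | ho
    · have := h1.not.2 (Nat.not_odd_iff_even.2 he)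
      rw [Nat.not_odd_iff_even] at this
      rcases this with ⟨a, ha⟩
      rcases he with ⟨b, hb⟩
      omega
    · rcases h1.2 ho with ⟨a, ha⟩
      rcases ho with ⟨b, hb⟩
      omega
  · intro K hK
    obtain ⟨c, hc, rfl⟩ := Finset.mem_image.1 hK
    constructor
    · have : (f c).card = c.supp.ncard := by
        rw [← Set.ncard_coe_finset, ← Set.ncard_image_of_injective _ Subtype.val_injective]
        congr 1
        ext w
        simp only [Finset.mem_coe, hfmem, Set.mem_image, ConnectedComponent.mem_supp_iff,
          Subtype.exists, exists_and_right, exists_eq_right]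
      rw [this]
      simpa [T] using hc
    · intro a ha b hb hab
      rw [hfmem] at ha hb
      obtain ⟨ha', rfl⟩ := ha
      by_contra hbu
      have hbu' : b ∈ ((⊤ : H.Subgraph).deleteVerts u).verts := by
        rw [hverts]; simpa using hbu
      refine hb ⟨hbu', ?_⟩
      rw [ConnectedComponent.eq]
      refine (Adj.reachable ?_).symm
      rw [hverts] at ha'
      simp only [hH', Subgraph.coe_adj, Subgraph.deleteVerts_adj, Subgraph.verts_top, Set.mem_univ,
        true_and, Subgraph.top_adj]
      exact ⟨ha', by simpa using hbu, hab⟩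
  · intro K hK L hL hne
    simp only [Finset.coe_image, Set.mem_image, Finset.mem_coe] at hK hL
    obtain ⟨c, _, rfl⟩ := hK
    obtain ⟨d, _, rfl⟩ := hL
    refine Finset.disjoint_left.2 fun w hw hw' => hne ?_
    rw [hdisj c d w hw hw']
namespace IsFactorPair
variable {G F : SimpleGraph V} {m : V → V} (h : IsFactorPair G F m)
include h

/-- Tutte's alternative for the contraction of the classes of `r` in `G`, where the edges `v, m v`
with `v ∈ Q` have been deleted. A perfect matching of the contraction is encoded by a relation `N`
on the vertices of `G`. -/
lemma contraction_alternative (r : Setoid V) (Q : Finset V) (hQ : ∀ q ∈ Q, m q ∈ Q)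
    (hr : ∀ v, Odd (Finset.univ.filter (r v)).card ∧
      (leavingDarts F (Finset.univ.filter (r v))).card ≤ 2 ∧
      (leavingDarts F (Finset.univ.filter (r v))).card +
        (leavingVerts m (Finset.univ.filter (r v))).card = 3) :
    (∃ N : V → V → Prop, (∀ v w, N v w → N w v) ∧
      (∀ v w, N v w → F.Adj v w ∨ (w = m v ∧ v ∉ Q)) ∧ (∀ v w, N v w → ¬ r v w) ∧
      ∀ v, ∃! p : V × V, r v p.1 ∧ N p.1 p.2) ∨
    ∃ (s : ℕ) (𝒦 : Finset (Finset V)), s + 2 ≤ 𝒦.card ∧ (∀ K ∈ 𝒦, Odd K.card) ∧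
      (𝒦 : Set (Finset V)).PairwiseDisjoint id ∧
      (∀ K ∈ 𝒦, ∀ v w, r v w → v ∈ K → w ∈ K) ∧
      ∑ K ∈ 𝒦, (leavingDarts F K).card ≤ 2 * s ∧
      ∑ K ∈ 𝒦, ((leavingDarts F K).card + (leavingVerts m K).card) ≤
        3 * s + (Q.filter fun q => ∃ K ∈ 𝒦, q ∈ K ∧ m q ∉ K).card := by
  let W := Quotient r
  let π : V → W := Quotient.mk r
  have hπ : ∀ v w, π v = π w ↔ r v w := fun v w => Quotient.eq
  have hsurj : Function.Surjective π := Quotient.mk_surjective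
  let P : W → Finset V := fun a => Finset.univ.filter fun v => π v = a
  have hP : ∀ v, P (π v) = Finset.univ.filter (r v) := fun v => by
    ext w; simp only [P, Finset.mem_filter, Finset.mem_univ, true_and, hπ]
    exact ⟨fun h => r.symm h, fun h => r.symm h⟩
  have hPmem : ∀ v a, v ∈ P a ↔ π v = a := by simp [P]
  have hP' : ∀ a, Odd (P a).card ∧ (leavingDarts F (P a)).card ≤ 2 ∧
      (leavingDarts F (P a)).card + (leavingVerts m (P a)).card = 3 := fun a => by
    obtain ⟨v, rfl⟩ := hsurj a
    rw [hP]; exact hr v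
  have hcardB : ∀ B : Finset W, (B.biUnion P).card = ∑ a ∈ B, (P a).card := fun B => by
    refine Finset.card_biUnion fun a _ b _ hab => Finset.disjoint_left.2 fun v hv hv' => hab ?_
    rw [← (hPmem _ _).1 hv, (hPmem _ _).1 hv']
  have hparB : ∀ B : Finset W, Odd (B.biUnion P).card ↔ Odd B.card := fun B => by
    rw [hcardB, Finset.odd_sum_iff_odd_card_odd]
    rw [Finset.filter_true_of_mem fun a _ => (hP' a).1]
  have hBmem : ∀ (B : Finset W) v, v ∈ B.biUnion P ↔ π v ∈ B := fun B v => by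
    simp [hPmem]
  let ok : V → V → Prop := fun v w => F.Adj v w ∨ (w = m v ∧ v ∉ Q)
  have oksymm : ∀ v w, ok v w → ok w v := by
    rintro v w (hvw | ⟨rfl, hv⟩)
    · exact Or.inl hvw.symm
    · exact Or.inr ⟨(h.invol v).symm, fun hq => hv (by simpa [h.invol] using hQ _ hq)⟩
  let H : SimpleGraph W :=
    { Adj := fun a b => a ≠ b ∧ ∃ v w, π v = a ∧ π w = b ∧ ok v w
      symm := ⟨fun a b ⟨hne, v, w, hv, hw, hvw⟩ => ⟨hne.symm, w, v, hw, hv, oksymm _ _ hvw⟩⟩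
      loopless := ⟨fun a ha => ha.1 rfl⟩ }
  -- All classes are odd, so `W` has the parity of `V`, and nothing leaves the whole vertex set.
  have hWeven : Even (Fintype.card W) := by
    rw [← Nat.not_odd_iff_even, ← Finset.card_univ, ← hparB, h.odd_card_iff]
    have : leavingVerts m (Finset.univ.biUnion P) = ∅ := by
      ext v; simp [hPmem]
    simp [this]
  rcases exists_isPerfectMatching_or_family H hWeven with ⟨M, hM⟩ | ⟨S, 𝒦, hcard, hK, hdis⟩
  · left
    -- Parallel edges merge in `H`, so one original edge is chosen per matching edge; choosing on
    -- `Sym2` makes the resulting `N` symmetric.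
    have hrep : ∀ e : Sym2 W, ∃ e' : Sym2 V, e ∈ M.edgeSet →
        (e'.map π = e ∧ ∀ v w, e' = s(v, w) → ok v w) := by
      intro e
      induction e using Sym2.ind with
      | _ a b =>
        by_cases he : s(a, b) ∈ M.edgeSet
        · obtain ⟨_, v, w, rfl, rfl, hvw⟩ := M.adj_sub he
          refine ⟨s(v, w), fun _ => ⟨rfl, fun x y hxy => ?_⟩⟩
          rcases Sym2.eq_iff.1 hxy with ⟨rfl, rfl⟩ | ⟨rfl, rfl⟩
          · exact hvw
          · exact oksymm _ _ hvw
        · obtain ⟨v, _⟩ := hsurj a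
          exact ⟨s(v, v), fun h => absurd h he⟩
    choose ρ hρ using hrep
    refine ⟨fun v w => M.Adj (π v) (π w) ∧ ρ s(π v, π w) = s(v, w), ?_, ?_, ?_, ?_⟩
    · rintro v w ⟨h1, h2⟩
      exact ⟨h1.symm, by rw [Sym2.eq_swap, h2, Sym2.eq_swap]⟩
    · rintro v w ⟨h1, h2⟩
      exact (hρ _ (Subgraph.mem_edgeSet.2 h1)).2 v w h2
    · rintro v w ⟨h1, _⟩ hvw
      exact (M.adj_sub h1).1 ((hπ _ _).2 hvw)
    · intro v
      obtain ⟨b, hb, hbu⟩ := hM.1 (hM.2 (π v))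
      have hb' := hρ s(π v, b) (Subgraph.mem_edgeSet.2 hb)
      have hex : ∃ x y, ρ s(π v, b) = s(x, y) ∧ π x = π v ∧ π y = b := by
        obtain ⟨x, y, hxy⟩ : ∃ x y, ρ s(π v, b) = s(x, y) := by
          induction ρ s(π v, b) using Sym2.ind with
          | _ x y => exact ⟨x, y, rfl⟩
        have h1 := hb'.1
        rw [hxy, Sym2.map_mk] at h1
        rcases Sym2.eq_iff.1 h1 with ⟨h1, h2⟩ | ⟨h1, h2⟩
        · exact ⟨x, y, hxy, h1, h2⟩
        · exact ⟨y, x, by rw [hxy, Sym2.eq_swap], h2, h1⟩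
      obtain ⟨x, y, hxy, hx, hy⟩ := hex
      refine ⟨(x, y), ⟨(hπ _ _).1 hx.symm, ?_, ?_⟩, ?_⟩
      · rw [hx, hy]; exact hb
      · rw [hx, hy]; exact hxy
      · rintro ⟨x', y'⟩ ⟨h1, h2, h3⟩
        simp only at h1 h2 h3
        have hx' : π x' = π v := ((hπ _ _).2 h1).symm
        rw [hx'] at h2 h3
        have hy' := hbu _ h2
        rw [hy', hxy] at h3
        rcases Sym2.eq_iff.1 h3 with ⟨rfl, rfl⟩ | ⟨rfl, rfl⟩
        · rfl
        · exact absurd (hx.symm.trans hy') (M.adj_sub hb).1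
  · right
    have hne : ∀ K ∈ 𝒦, ∀ L ∈ 𝒦, ∀ v, π v ∈ K → π v ∈ L → K = L := by
      intro K hK' L hL v hv hv'
      by_contra hKL
      exact Finset.disjoint_left.1 (hdis hK' hL hKL) hv hv'
    have hinj : Set.InjOn (fun K : Finset W => K.biUnion P) (𝒦 : Set (Finset W)) := by
      intro K hK1 L hL1 hKL
      obtain ⟨a, ha⟩ := Finset.card_pos.1 (hK K hK1).1.pos
      obtain ⟨v, rfl⟩ := hsurj a
      refine hne K hK1 L hL1 v ha ?_
      rw [← hBmem] at ha ⊢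
      simp only at hKL
      rwa [← hKL]
    have hout : ∀ K ∈ 𝒦, ∀ v w, π v ∈ K → π w ∉ K → ok v w → π w ∈ S := fun K hK' v w hv hw hok =>
      (hK K hK').2 _ hv _ hw ⟨fun h => hw (h ▸ hv), v, w, rfl, rfl, hok⟩
    have hpd : ∀ K ∈ 𝒦, ∀ L ∈ 𝒦, K ≠ L → ∀ v, v ∈ K.biUnion P → v ∉ L.biUnion P := by
      intro K hK1 L hL1 hKL v hv hv'
      rw [hBmem] at hv hv'
      exact hKL (hne K hK1 L hL1 v hv hv')
    -- Reversing an `F`-dart that leaves a member of `𝒦` gives one that leaves a class belonging to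
    -- `S`.
    have hdarts : ∑ K ∈ 𝒦, (leavingDarts F (K.biUnion P)).card ≤
        ∑ a ∈ S, (leavingDarts F (P a)).card := by
      rw [← Finset.card_biUnion]
      · refine le_trans (Finset.card_le_card_of_injOn Prod.swap ?_ Prod.swap_injective.injOn)
          (Finset.card_biUnion_le (s := S) (t := fun a => leavingDarts F (P a)))
        rintro ⟨v, w⟩ hvw
        simp only [Finset.coe_biUnion, Set.mem_iUnion, Finset.mem_coe, mem_leavingDarts] at hvw ⊢
        obtain ⟨K, hK', hv, hw, hadj⟩ := hvw
        rw [hBmem] at hv hw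
        refine ⟨π w, hout K hK' v w hv hw (Or.inl hadj), (hPmem _ _).2 rfl, ?_, hadj.symm⟩
        rw [hPmem]
        exact fun h => hw (h ▸ hv)
      · intro K hK1 L hL1 hKL
        refine Finset.disjoint_left.2 fun p hp hp' => ?_
        rw [mem_leavingDarts] at hp hp'
        exact hpd K hK1 L hL1 hKL _ hp.1 hp'.1
    -- A partner edge leaving a member of `𝒦` either is forbidden or ends in a class belonging to
    -- `S`.
    have hverts : ∑ K ∈ 𝒦, (leavingVerts m (K.biUnion P)).card ≤
        ∑ a ∈ S, (leavingVerts m (P a)).card + (Q.filter fun q =>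
          ∃ K ∈ 𝒦.image (fun K => K.biUnion P), q ∈ K ∧ m q ∉ K).card := by
      rw [← Finset.card_biUnion]
      · calc _ ≤ ((S.biUnion fun a => leavingVerts m (P a)).image m ∪ Q.filter fun q =>
              ∃ K ∈ 𝒦.image (fun K => K.biUnion P), q ∈ K ∧ m q ∉ K).card := by
              refine Finset.card_le_card fun v hv => ?_
              rw [Finset.mem_biUnion] at hv
              obtain ⟨K, hK', hv⟩ := hv
              rw [mem_leavingVerts] at hv
              rw [Finset.mem_union]
              by_cases hvQ : v ∈ Q
              · right
                exact Finset.mem_filter.2 ⟨hvQ, _, Finset.mem_image_of_mem _ hK', hv⟩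
              · left
                rw [hBmem, hBmem] at hv
                refine Finset.mem_image.2 ⟨m v, Finset.mem_biUnion.2 ⟨π (m v),
                  hout K hK' v _ hv.1 hv.2 (Or.inr ⟨rfl, hvQ⟩), ?_⟩, h.invol v⟩
                rw [mem_leavingVerts, hPmem, hPmem, h.invol]
                exact ⟨rfl, fun h => hv.2 (h ▸ hv.1)⟩
          _ ≤ _ := (Finset.card_union_le _ _).trans (Nat.add_le_add_right
              (Finset.card_image_le.trans Finset.card_biUnion_le) _)
      · intro K hK1 L hL1 hKL
        refine Finset.disjoint_left.2 fun p hp hp' => ?_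
        rw [mem_leavingVerts] at hp hp'
        exact hpd K hK1 L hL1 hKL _ hp.1 hp'.1
    refine ⟨S.card, 𝒦.image fun K => K.biUnion P, ?_, ?_, ?_, ?_, ?_, ?_⟩
    · rwa [Finset.card_image_of_injOn hinj]
    · intro K hK'
      obtain ⟨K, hK1, rfl⟩ := Finset.mem_image.1 hK'
      exact (hparB K).2 (hK K hK1).1
    · intro K hK' L hL' hKL
      simp only [Finset.coe_image, Set.mem_image, Finset.mem_coe] at hK' hL'
      obtain ⟨K, hK1, rfl⟩ := hK'
      obtain ⟨L, hL1, rfl⟩ := hL'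
      exact Finset.disjoint_left.2 (hpd K hK1 L hL1 fun h => hKL (h ▸ rfl))
    · intro K hK' v w hvw hv
      obtain ⟨K, hK1, rfl⟩ := Finset.mem_image.1 hK'
      rw [hBmem] at hv ⊢
      rwa [← (hπ _ _).2 hvw]
    · rw [Finset.sum_image hinj]
      refine hdarts.trans ((Finset.sum_le_card_nsmul _ _ 2 fun a _ => (hP' a).2.1).trans ?_)
      rw [smul_eq_mul, mul_comm]
    · rw [Finset.sum_image hinj, Finset.sum_add_distrib]
      have : ∑ a ∈ S, (leavingDarts F (P a)).card + ∑ a ∈ S, (leavingVerts m (P a)).card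
          = 3 * S.card := by
        rw [← Finset.sum_add_distrib, Finset.sum_congr rfl fun a _ => (hP' a).2.2]
        simp [mul_comm]
      omega

end IsFactorPair
-- Counting obstructions with at most four forbidden edges
/-- An odd set left by no edge of `F` and by exactly three partner edges. -/
def IsFullCut (F : SimpleGraph V) (m : V → V) (X : Finset V) : Prop :=
  leavingDarts F X = ∅ ∧ Odd X.card ∧ (leavingVerts m X).card = 3

/-- The matching relation `N` encodes a perfect matching of the contraction of the classes of `r`,
using no edge `v, m v` with `v ∈ Q`. -/
structure IsContractedMatching (F : SimpleGraph V) (m : V → V) (r : Setoid V) (Q : Finset V)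
    (N : V → V → Prop) : Prop where
  symm : ∀ v w, N v w → N w v
  allowed : ∀ v w, N v w → F.Adj v w ∨ (w = m v ∧ v ∉ Q)
  crossing : ∀ v w, N v w → ¬ r v w
  unique : ∀ v, ∃! p : V × V, r v p.1 ∧ N p.1 p.2

/-- Every class of `r` is a singleton or a full cut. -/
def HasFullClasses (F : SimpleGraph V) (m : V → V) (r : Setoid V) : Prop :=
  ∀ v, Finset.univ.filter (r v) = {v} ∨ IsFullCut F m (Finset.univ.filter (r v))

namespace IsFactorPair
variable {G F : SimpleGraph V} {m : V → V} (h : IsFactorPair G F m)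
include h

lemma card_leavingDarts_singleton (v : V) : (leavingDarts F {v}).card = 2 := by
  rw [← h.two v]
  refine Finset.card_nbij' (fun p => p.2) (fun w => (v, w)) ?_ ?_ ?_ ?_
  · rintro ⟨a, b⟩ hp
    simp only [Finset.mem_coe, mem_leavingDarts, Finset.mem_singleton] at hp
    obtain ⟨rfl, _, hab⟩ := hp
    simpa using hab
  · intro w hw
    simp only [Finset.coe_filter, Finset.mem_univ, true_and, Set.mem_ofPred_eq] at hw
    simpa [hw] using hw.ne'
  · rintro ⟨a, b⟩ hp
    simp only [Finset.mem_coe, mem_leavingDarts, Finset.mem_singleton] at hp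
    rw [hp.1]
  · intro w _; rfl

lemma card_leavingVerts_singleton (v : V) : (leavingVerts m {v}).card = 1 := by
  rw [Finset.card_eq_one]
  refine ⟨v, ?_⟩
  ext w
  simp only [mem_leavingVerts, Finset.mem_singleton]
  exact ⟨And.left, fun hw => ⟨hw, by rw [hw]; exact h.partner_ne v⟩⟩

lemma class_counts {r : Setoid V} (hr : HasFullClasses F m r) (v : V) :
    Odd (Finset.univ.filter (r v)).card ∧
      (leavingDarts F (Finset.univ.filter (r v))).card ≤ 2 ∧
      (leavingDarts F (Finset.univ.filter (r v))).card +
        (leavingVerts m (Finset.univ.filter (r v))).card = 3 := by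
  rcases hr v with hv | ⟨h1, h2, h3⟩
  · rw [hv, h.card_leavingDarts_singleton, h.card_leavingVerts_singleton]
    simp
  · rw [h1, h3]
    exact ⟨h2, by simp, by simp⟩

/-- An obstruction gives `3(s + 2) ≤ 3s + |Q| ≤ 3s + 6`, so equality holds everywhere: each odd set
is left by exactly three edges and each forbidden edge leaves the set containing either end. As `F`
supplies at most `2s` of the ends, two of the sets are left by no `F`-edge. -/
lemma exists_contractedMatching_or_two_fullCuts {r : Setoid V} (hr : HasFullClasses F m r)
    {Q : Finset V} (hQ : ∀ q ∈ Q, m q ∈ Q) (hcard : Q.card ≤ 6) :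
    (∃ N, IsContractedMatching F m r Q N) ∨
    (6 ≤ Q.card ∧ ∃ K L : Finset V, Disjoint K L ∧ IsFullCut F m K ∧ IsFullCut F m L ∧
      (∀ v w, r v w → v ∈ K → w ∈ K) ∧ (∀ v w, r v w → v ∈ L → w ∈ L) ∧
      (∀ q ∈ Q, q ∈ K → m q ∉ K) ∧ (∀ q ∈ Q, q ∈ L → m q ∉ L)) := by
  rcases h.contraction_alternative r Q hQ (h.class_counts hr) with
    ⟨N, h1, h2, h3, h4⟩ | ⟨s, 𝒦, hs, hodd, hdis, hsat, hF, hG⟩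
  · exact Or.inl ⟨N, h1, h2, h3, h4⟩
  right
  have hle : (Q.filter fun q => ∃ K ∈ 𝒦, q ∈ K ∧ m q ∉ K).card ≤ Q.card :=
    Finset.card_filter_le _ _
  have h3 : ∀ K ∈ 𝒦, 3 ≤ (leavingDarts F K).card + (leavingVerts m K).card :=
    fun K hK => h.three_le_of_odd (hodd K hK)
  have hsum := Finset.card_nsmul_le_sum 𝒦 _ 3 h3
  rw [smul_eq_mul] at hsum
  have hQe : (Q.filter fun q => ∃ K ∈ 𝒦, q ∈ K ∧ m q ∉ K) = Q :=
    Finset.eq_of_subset_of_card_le (Finset.filter_subset _ _) (by omega)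
  have heq : ∀ K ∈ 𝒦, (leavingDarts F K).card + (leavingVerts m K).card = 3 := by
    have : ∑ K ∈ 𝒦, 3 = ∑ K ∈ 𝒦, ((leavingDarts F K).card + (leavingVerts m K).card) := by
      rw [Finset.sum_const, smul_eq_mul]; omega
    exact fun K hK => ((Finset.sum_eq_sum_iff_of_le h3).1 this K hK).symm
  -- The number of leaving `F`-edges is even, so it is zero or at least two; summing gives at least
  -- two zeros.
  have hz : ∀ K ∈ 𝒦, 2 ≤ (leavingDarts F K).card + 2 * (if leavingDarts F K = ∅ then 1 else 0) := by
    intro K hK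
    split_ifs with h0
    · omega
    · have := Finset.card_pos.2 (Finset.nonempty_iff_ne_empty.2 h0)
      obtain ⟨a, ha⟩ := h.even_card_leavingDarts K
      omega
  have hsum2 := Finset.card_nsmul_le_sum 𝒦 _ 2 hz
  rw [Finset.sum_add_distrib, ← Finset.mul_sum, ← Finset.card_filter, smul_eq_mul] at hsum2
  obtain ⟨K, hK, L, hL, hKL⟩ := Finset.one_lt_card.1
    (show 1 < (𝒦.filter fun K => leavingDarts F K = ∅).card by omega)
  rw [Finset.mem_filter] at hK hL
  have hfull : ∀ K ∈ 𝒦, leavingDarts F K = ∅ → IsFullCut F m K := fun K hK h0 =>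
    ⟨h0, hodd K hK, by have := heq K hK; rw [h0] at this; simpa using this⟩
  have hq : ∀ K ∈ 𝒦, ∀ q ∈ Q, q ∈ K → m q ∉ K := by
    intro K hK q hq hqK
    rw [← hQe, Finset.mem_filter] at hq
    obtain ⟨_, K', hK', hqK', hq'⟩ := hq
    have : K = K' := by
      by_contra hne
      exact Finset.disjoint_left.1 (hdis hK hK' hne) hqK hqK'
    rwa [this]
  refine ⟨by omega, K, L, hdis hK.1 hL.1 hKL, hfull K hK.1 hK.2, hfull L hL.1 hL.2, hsat K hK.1,
    hsat L hL.1, hq K hK.1, hq L hL.1⟩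

lemma exists_contractedMatching_of_card_lt {r : Setoid V} (hr : HasFullClasses F m r)
    {Q : Finset V} (hQ : ∀ q ∈ Q, m q ∈ Q) (hcard : Q.card < 6) :
    ∃ N, IsContractedMatching F m r Q N :=
  (h.exists_contractedMatching_or_two_fullCuts hr hQ hcard.le).resolve_right
    fun h' => absurd h'.1 (by omega)

lemma exists_contractedMatching_or_fullCut {r : Setoid V} (hr : HasFullClasses F m r)
    {Q : Finset V} (hQ : ∀ q ∈ Q, m q ∈ Q) (hcard : Q.card ≤ 8) :
    (∃ N, IsContractedMatching F m r Q N) ∨ ∃ K : Finset V, IsFullCut F m K := by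
  rcases h.contraction_alternative r Q hQ (h.class_counts hr) with
    ⟨N, h1, h2, h3, h4⟩ | ⟨s, 𝒦, hs, hodd, hdis, hsat, hF, hG⟩
  · exact Or.inl ⟨N, h1, h2, h3, h4⟩
  right
  by_contra! hno
  have hle : (Q.filter fun q => ∃ K ∈ 𝒦, q ∈ K ∧ m q ∉ K).card ≤ Q.card :=
    Finset.card_filter_le _ _
  -- Counting `F`-edges twice gives each non-full odd set weight at least five, but the total is at
  -- most `2s + 3s + 8 < 5(s + 2)`.
  have h5 : ∀ K ∈ 𝒦, 5 ≤ (leavingDarts F K).card +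
      ((leavingDarts F K).card + (leavingVerts m K).card) := by
    intro K hK
    have h3 := h.three_le_of_odd (hodd K hK)
    obtain ⟨a, ha⟩ := h.even_card_leavingDarts K
    obtain ⟨b, hb⟩ := (h.odd_card_iff K).1 (hodd K hK)
    by_cases h0 : leavingDarts F K = ∅
    · have : (leavingVerts m K).card ≠ 3 := fun h' => hno K ⟨h0, hodd K hK, h'⟩
      omega
    · have := Finset.card_pos.2 (Finset.nonempty_iff_ne_empty.2 h0)
      omega
  have hsum := Finset.card_nsmul_le_sum 𝒦 _ 5 h5
  rw [smul_eq_mul, Finset.sum_add_distrib] at hsum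
  omega

end IsFactorPair

/-! ### Unions of components of the 2-factor -/

/-- The vertex set of a component, as a finset. -/
noncomputable def compVerts (F : SimpleGraph V) (c : F.ConnectedComponent) : Finset V :=
  Finset.univ.filter fun v => F.connectedComponentMk v = c

/-- The components of odd order, as a finset. -/
noncomputable def oddComps (F : SimpleGraph V) : Finset F.ConnectedComponent :=
  Finset.univ.filter fun c => Odd (compVerts F c).card

@[simp] lemma mem_compVerts {F : SimpleGraph V} {c : F.ConnectedComponent} {v : V} :
    v ∈ compVerts F c ↔ F.connectedComponentMk v = c := by simp [compVerts]

lemma mem_oddComps {F : SimpleGraph V} {c : F.ConnectedComponent} :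
    c ∈ oddComps F ↔ Odd (compVerts F c).card := by simp [oddComps]

lemma compVerts_nonempty (F : SimpleGraph V) (c : F.ConnectedComponent) :
    (compVerts F c).Nonempty := by
  induction c using ConnectedComponent.ind with
  | h v => exact ⟨v, by simp⟩

section closed
variable {F : SimpleGraph V} {X Y : Finset V}

lemma leavingDarts_eq_empty : leavingDarts F X = ∅ ↔ ∀ v ∈ X, ∀ w, F.Adj v w → w ∈ X := by
  rw [Finset.eq_empty_iff_forall_notMem]
  simp only [mem_leavingDarts, Prod.forall]
  exact ⟨fun h v hv w hvw => by_contra fun hw => h v w ⟨hv, hw, hvw⟩,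
    fun h v w hvw => hvw.2.1 (h v hvw.1 w hvw.2.2)⟩

lemma leavingDarts_compl (hX : leavingDarts F X = ∅) : leavingDarts F Xᶜ = ∅ := by
  rw [leavingDarts_eq_empty] at *
  intro v hv w hvw
  rw [Finset.mem_compl] at *
  exact fun hw => hv (hX w hw v hvw.symm)

lemma leavingDarts_inter (hX : leavingDarts F X = ∅) (hY : leavingDarts F Y = ∅) :
    leavingDarts F (X ∩ Y) = ∅ := by
  rw [leavingDarts_eq_empty] at *
  intro v hv w hvw
  rw [Finset.mem_inter] at *
  exact ⟨hX v hv.1 w hvw, hY v hv.2 w hvw⟩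

lemma leavingDarts_union (hX : leavingDarts F X = ∅) (hY : leavingDarts F Y = ∅) :
    leavingDarts F (X ∪ Y) = ∅ := by
  rw [leavingDarts_eq_empty] at *
  intro v hv w hvw
  rw [Finset.mem_union] at *
  exact hv.imp (fun h => hX v h w hvw) (fun h => hY v h w hvw)

lemma mem_of_connectedComponentMk_eq (hX : leavingDarts F X = ∅) {v w : V} (hv : v ∈ X)
    (hvw : F.connectedComponentMk v = F.connectedComponentMk w) : w ∈ X := by
  rw [leavingDarts_eq_empty] at hX
  obtain ⟨p⟩ := ConnectedComponent.exact hvw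
  induction p with
  | nil => exact hv
  | cons hac p ih => exact ih (hX _ hv _ hac) (ConnectedComponent.sound p.reachable)

lemma compVerts_subset (hX : leavingDarts F X = ∅) {c : F.ConnectedComponent} {v : V}
    (hv : v ∈ X) (hvc : v ∈ compVerts F c) : compVerts F c ⊆ X := fun _ hw =>
  mem_of_connectedComponentMk_eq hX hv ((mem_compVerts.1 hvc).trans (mem_compVerts.1 hw).symm)

lemma compVerts_subset_compl (hX : leavingDarts F X = ∅) (c : F.ConnectedComponent) :
    compVerts F c ⊆ Xᶜ ↔ ¬ compVerts F c ⊆ X := by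
  obtain ⟨v, hv⟩ := compVerts_nonempty F c
  constructor
  · exact fun h h' => Finset.mem_compl.1 (h hv) (h' hv)
  · exact fun h w hw => Finset.mem_compl.2 fun hwX => h (compVerts_subset hX hwX hw)

lemma compVerts_subset_union (hX : leavingDarts F X = ∅) (hY : leavingDarts F Y = ∅)
    (c : F.ConnectedComponent) :
    compVerts F c ⊆ X ∪ Y ↔ compVerts F c ⊆ X ∨ compVerts F c ⊆ Y := by
  constructor
  · intro h
    obtain ⟨v, hv⟩ := compVerts_nonempty F c
    exact (Finset.mem_union.1 (h hv)).imp (fun h => compVerts_subset hX h hv)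
      (fun h => compVerts_subset hY h hv)
  · rintro (h | h)
    · exact h.trans Finset.subset_union_left
    · exact h.trans Finset.subset_union_right

lemma odd_card_iff_odd_card_oddComps (hX : leavingDarts F X = ∅) :
    Odd X.card ↔ Odd ((oddComps F).filter fun c => compVerts F c ⊆ X).card := by
  rw [Finset.card_eq_sum_card_fiberwise (f := F.connectedComponentMk) (t := Finset.univ)
    (fun _ _ => Finset.mem_coe.2 (Finset.mem_univ _)), Finset.odd_sum_iff_odd_card_odd]
  suffices (Finset.univ.filter fun c : F.ConnectedComponent =>
      Odd (X.filter fun v => F.connectedComponentMk v = c).card) =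
      (oddComps F).filter fun c => compVerts F c ⊆ X by rw [this]
  ext c
  simp only [Finset.mem_filter, Finset.mem_univ, true_and, mem_oddComps]
  have hsub : compVerts F c ⊆ X → (X.filter fun v => F.connectedComponentMk v = c) = compVerts F c := by
    intro h
    ext v
    simp only [Finset.mem_filter, mem_compVerts]
    exact ⟨And.right, fun hv => ⟨h (mem_compVerts.2 hv), hv⟩⟩
  constructor
  · intro ho
    obtain ⟨v, hv⟩ := Finset.card_pos.1 ho.pos
    rw [Finset.mem_filter] at hv
    have := compVerts_subset hX hv.1 (mem_compVerts.2 hv.2)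
    rw [hsub this] at ho
    exact ⟨ho, this⟩
  · rintro ⟨ho, h⟩
    rwa [hsub h]

end closed

/-! ### Uncrossing cuts around one odd component -/

/-- `X` is left by no edge of `F` and by exactly three partner edges, and `c` is the only odd
component of `F` inside `X`. -/
def IsCutAround (F : SimpleGraph V) (m : V → V) (c : F.ConnectedComponent) (X : Finset V) : Prop :=
  leavingDarts F X = ∅ ∧ (leavingVerts m X).card = 3 ∧
    ∀ d ∈ oddComps F, compVerts F d ⊆ X ↔ d = c

lemma card_leavingVerts_inter_add_union (m : V → V) (X Y : Finset V) :
    (leavingVerts m (X ∩ Y)).card + (leavingVerts m (X ∪ Y)).card ≤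
      (leavingVerts m X).card + (leavingVerts m Y).card := by
  simp only [leavingVerts, Finset.card_filter, ← Finset.sum_add_distrib]
  refine Finset.sum_le_sum fun v _ => ?_
  simp only [Finset.mem_inter, Finset.mem_union]
  by_cases h1 : v ∈ X <;> by_cases h2 : v ∈ Y <;> by_cases h3 : m v ∈ X <;>
    by_cases h4 : m v ∈ Y <;> simp [h1, h2, h3, h4]

lemma odd_card_of_unique_oddComp {F : SimpleGraph V} {c : F.ConnectedComponent} {X : Finset V}
    (hX : leavingDarts F X = ∅) (hc : c ∈ oddComps F)
    (huniq : ∀ d ∈ oddComps F, compVerts F d ⊆ X ↔ d = c) : Odd X.card := by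
  rw [odd_card_iff_odd_card_oddComps hX]
  have : ((oddComps F).filter fun d => compVerts F d ⊆ X) = {c} := by
    ext d
    simp only [Finset.mem_filter, Finset.mem_singleton]
    exact ⟨fun hd => (huniq d hd.1).1 hd.2, fun hd => hd ▸ ⟨hc, (huniq c hc).2 rfl⟩⟩
  simp [this]

namespace IsCutAround
variable {F : SimpleGraph V} {m : V → V} {c c' : F.ConnectedComponent} {X Y : Finset V}

lemma odd_card (hX : IsCutAround F m c X) (hc : c ∈ oddComps F) : Odd X.card :=
  odd_card_of_unique_oddComp hX.1 hc hX.2.2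

lemma isFullCut (hX : IsCutAround F m c X) (hc : c ∈ oddComps F) : IsFullCut F m X :=
  ⟨hX.1, hX.odd_card hc, hX.2.1⟩

lemma compVerts_subset (hX : IsCutAround F m c X) (hc : c ∈ oddComps F) : compVerts F c ⊆ X :=
  (hX.2.2 c hc).2 rfl

end IsCutAround

namespace IsFactorPair
variable {G F : SimpleGraph V} {m : V → V} (h : IsFactorPair G F m)
include h

lemma card_leavingVerts_compl (X : Finset V) :
    (leavingVerts m Xᶜ).card = (leavingVerts m X).card := by
  refine Finset.card_nbij' m m ?_ ?_ (fun v _ => h.invol v) (fun v _ => h.invol v)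
  · intro v hv
    simp only [Finset.mem_coe, mem_leavingVerts, Finset.mem_compl, not_not, h.invol] at *
    exact hv.symm
  · intro v hv
    simp only [Finset.mem_coe, mem_leavingVerts, Finset.mem_compl, not_not, h.invol] at *
    exact hv.symm

lemma three_le_of_closed {X : Finset V} (hX : leavingDarts F X = ∅) (ho : Odd X.card) :
    3 ≤ (leavingVerts m X).card := by
  have := h.three_le_of_odd ho
  rwa [hX, Finset.card_empty, zero_add] at this

lemma odd_card_compl {X : Finset V} : Odd Xᶜ.card ↔ Odd X.card := by
  rw [h.odd_card_iff Xᶜ, h.odd_card_iff X, h.card_leavingVerts_compl]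

lemma isFullCut_compl {X : Finset V} (hX : IsFullCut F m X) : IsFullCut F m Xᶜ :=
  ⟨leavingDarts_compl hX.1, h.odd_card_compl.2 hX.2.1, by rw [h.card_leavingVerts_compl, hX.2.2]⟩

/-- Both sets are odd and closed, hence left by at least three edges each; submodularity bounds the
sum by six. -/
lemma isCutAround_inter_union {c : F.ConnectedComponent} {X Y : Finset V} (hc : c ∈ oddComps F)
    (hX : IsCutAround F m c X) (hY : IsCutAround F m c Y) :
    IsCutAround F m c (X ∩ Y) ∧ IsCutAround F m c (X ∪ Y) := by
  have hi := leavingDarts_inter hX.1 hY.1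
  have hu := leavingDarts_union hX.1 hY.1
  have hi' : ∀ d ∈ oddComps F, compVerts F d ⊆ X ∩ Y ↔ d = c := fun d hd => by
    rw [Finset.subset_inter_iff, hX.2.2 d hd, hY.2.2 d hd, and_self]
  have hu' : ∀ d ∈ oddComps F, compVerts F d ⊆ X ∪ Y ↔ d = c := fun d hd => by
    rw [compVerts_subset_union hX.1 hY.1, hX.2.2 d hd, hY.2.2 d hd, or_self]
  have h1 := h.three_le_of_closed hi (odd_card_of_unique_oddComp hi hc hi')
  have h2 := h.three_le_of_closed hu (odd_card_of_unique_oddComp hu hc hu')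
  have h3 := card_leavingVerts_inter_add_union m X Y
  have h4 := hX.2.1
  have h5 := hY.2.1
  exact ⟨⟨hi, by omega, hi'⟩, ⟨hu, by omega, hu'⟩⟩

/-- Submodularity for `X` and `Yᶜ`: the two differences isolate `c` and `c'`, so both are odd and
each attains three. -/
lemma isCutAround_sdiff {c c' : F.ConnectedComponent} {X Y : Finset V} (hc : c ∈ oddComps F)
    (hc' : c' ∈ oddComps F) (hne : c ≠ c')
    (hX : IsCutAround F m c X) (hY : IsCutAround F m c' Y) : IsCutAround F m c (X ∩ Yᶜ) := by
  have hi := leavingDarts_inter hX.1 (leavingDarts_compl hY.1)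
  have hi2 := leavingDarts_inter hY.1 (leavingDarts_compl hX.1)
  have hi' : ∀ d ∈ oddComps F, compVerts F d ⊆ X ∩ Yᶜ ↔ d = c := fun d hd => by
    rw [Finset.subset_inter_iff, compVerts_subset_compl hY.1, hX.2.2 d hd, hY.2.2 d hd]
    exact ⟨And.left, fun h => ⟨h, h ▸ hne⟩⟩
  have hi2' : ∀ d ∈ oddComps F, compVerts F d ⊆ Y ∩ Xᶜ ↔ d = c' := fun d hd => by
    rw [Finset.subset_inter_iff, compVerts_subset_compl hX.1, hX.2.2 d hd, hY.2.2 d hd]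
    exact ⟨And.left, fun h => ⟨h, h ▸ hne.symm⟩⟩
  have h1 := h.three_le_of_closed hi (odd_card_of_unique_oddComp hi hc hi')
  have h2 := h.three_le_of_closed hi2 (odd_card_of_unique_oddComp hi2 hc' hi2')
  have h3 := card_leavingVerts_inter_add_union m X Yᶜ
  have h4 := hX.2.1
  have h5 := hY.2.1
  have h6 : X ∪ Yᶜ = (Y ∩ Xᶜ)ᶜ := by ext; simp; tauto
  rw [h6, h.card_leavingVerts_compl, h.card_leavingVerts_compl] at h3
  exact ⟨hi, by omega, hi'⟩

/-- An odd closed set contains an odd number of the four odd components: one or three. -/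
lemma exists_isCutAround_of_isFullCut (h4 : (oddComps F).card = 4) {K : Finset V}
    (hK : IsFullCut F m K) :
    ∃ c ∈ oddComps F, IsCutAround F m c K ∨ IsCutAround F m c Kᶜ := by
  have ho := (odd_card_iff_odd_card_oddComps hK.1).1 hK.2.1
  have hsplit := Finset.card_filter_add_card_filter_not (s := oddComps F)
    (fun c => compVerts F c ⊆ K)
  have hcases : ((oddComps F).filter fun c => compVerts F c ⊆ K).card = 1 ∨
      ((oddComps F).filter fun c => ¬ compVerts F c ⊆ K).card = 1 := by
    obtain ⟨k, hk⟩ := ho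
    omega
  rcases hcases with hc | hc
  · obtain ⟨c, hc⟩ := Finset.card_eq_one.1 hc
    have hmem : ∀ d, (d ∈ oddComps F ∧ compVerts F d ⊆ K) ↔ d = c := fun d => by
      rw [← Finset.mem_singleton, ← hc, Finset.mem_filter]
    exact ⟨c, ((hmem c).2 rfl).1, Or.inl ⟨hK.1, hK.2.2, fun d hd => by rw [← hmem]; tauto⟩⟩
  · obtain ⟨c, hc⟩ := Finset.card_eq_one.1 hc
    have hmem : ∀ d, (d ∈ oddComps F ∧ ¬ compVerts F d ⊆ K) ↔ d = c := fun d => by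
      rw [← Finset.mem_singleton, ← hc, Finset.mem_filter]
    refine ⟨c, ((hmem c).2 rfl).1, Or.inr ⟨leavingDarts_compl hK.1, ?_, fun d hd => ?_⟩⟩
    · rw [h.card_leavingVerts_compl, hK.2.2]
    · rw [← hmem, compVerts_subset_compl hK.1]; tauto

end IsFactorPair
-- Matchings inside minimal cuts, and gluing
omit [Fintype V] in
lemma card_union_image_le (m : V → V) (Q : Finset V) : (Q ∪ Q.image m).card ≤ 2 * Q.card := by
  have h1 := Finset.card_union_le Q (Q.image m)
  have h2 := Finset.card_image_le (s := Q) (f := m)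
  omega

namespace IsFactorPair
variable {G F : SimpleGraph V} {m : V → V} (h : IsFactorPair G F m)
include h

lemma partner_mem_union_image (Q : Finset V) : ∀ q ∈ Q ∪ Q.image m, m q ∈ Q ∪ Q.image m := by
  intro q hq
  rcases Finset.mem_union.1 hq with hq | hq
  · exact Finset.mem_union_right _ (Finset.mem_image_of_mem _ hq)
  · obtain ⟨x, hx, rfl⟩ := Finset.mem_image.1 hq
    rw [h.invol]
    exact Finset.mem_union_left _ hx

lemma exists_ne_mem_compVerts (c : F.ConnectedComponent) (u : V) : ∃ p ∈ compVerts F c, p ≠ u := by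
  obtain ⟨v, hv⟩ := compVerts_nonempty F c
  by_cases hvu : v = u
  · have : 0 < (Finset.univ.filter (F.Adj v)).card := by rw [h.two]; norm_num
    obtain ⟨w, hw⟩ := Finset.card_pos.1 this
    rw [Finset.mem_filter] at hw
    refine ⟨w, ?_, hvu ▸ hw.2.ne'⟩
    rw [mem_compVerts] at *
    rw [← hv]
    exact (ConnectedComponent.sound hw.2.reachable).symm
  · exact ⟨v, hv, hvu⟩

lemma two_le_card_compVerts (c : F.ConnectedComponent) : 2 ≤ (compVerts F c).card := by
  obtain ⟨u, hu⟩ := compVerts_nonempty F c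
  obtain ⟨v, hv, hne⟩ := h.exists_ne_mem_compVerts c u
  exact Finset.one_lt_card.2 ⟨v, hv, u, hu, hne⟩

lemma hasFullClasses_compl {X : Finset V} (hX : IsFullCut F m X) (r : Setoid V)
    (hr : ∀ v w, r v w ↔ v = w ∨ (v ∉ X ∧ w ∉ X)) : HasFullClasses F m r := by
  intro v
  by_cases hv : v ∈ X
  · left
    ext w
    simp only [Finset.mem_filter, Finset.mem_univ, true_and, hr, Finset.mem_singleton]
    exact ⟨fun h => h.elim Eq.symm fun h => absurd hv h.1, fun h => Or.inl h.symm⟩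
  · right
    have : Finset.univ.filter (r v) = Xᶜ := by
      ext w
      simp only [Finset.mem_filter, Finset.mem_univ, true_and, hr, Finset.mem_compl]
      exact ⟨fun h => h.elim (fun h => h ▸ hv) And.right, fun h => Or.inr ⟨hv, h⟩⟩
    rw [this]
    exact h.isFullCut_compl hX

/-- Inside a minimal cut `X` around an odd component `c` there is, for every partner edge `u, m u`
leaving `X`, a matching of `X` using this edge and missing some partner edge at `c`. -/
lemma exists_inner_matching {c : F.ConnectedComponent} (hc : c ∈ oddComps F) {X : Finset V}
    (hX : IsCutAround F m c X) (hmin : ∀ Y, IsCutAround F m c Y → Y ⊆ X → Y = X) {u : V}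
    (hu : u ∈ X) (hmu : m u ∉ X) :
    ∃ n : V → V, n u = m u ∧ (∀ x ∈ X, x ≠ u → n x ∈ X ∧ n (n x) = x) ∧
      (∀ x ∈ X, G.Adj x (n x)) ∧ ∃ p ∈ compVerts F c, n p ≠ m p := by
  let r : Setoid V :=
    { r := fun v w => v = w ∨ (v ∉ X ∧ w ∉ X)
      iseqv := ⟨fun _ => Or.inl rfl, fun h => h.imp Eq.symm And.symm, by
        rintro x y z (rfl | h) (rfl | h')
        exacts [Or.inl rfl, Or.inr h', Or.inr h, Or.inr ⟨h.1, h'.2⟩]⟩ }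
  have hr : ∀ v w, r v w ↔ v = w ∨ (v ∉ X ∧ w ∉ X) := fun _ _ => Iff.rfl
  have hcX := hX.compVerts_subset hc
  have hfull := h.hasFullClasses_compl (hX.isFullCut hc) r hr
  -- Forbidding the other two leaving edges forces the matching to cross the cut at `u`.
  let Q₀ := (leavingVerts m X).erase u
  have hQ₀ : Q₀.card ≤ 2 := by
    rw [Finset.card_erase_of_mem (mem_leavingVerts.2 ⟨hu, hmu⟩), hX.2.1]
  have key : ∃ Q : Finset V, Q₀ ⊆ Q ∧ (∀ q ∈ Q, m q ∈ Q) ∧ (∃ p ∈ compVerts F c, p ∈ Q) ∧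
      ∃ N, IsContractedMatching F m r Q N := by
    by_cases hp : ∃ p ∈ compVerts F c, m p ∈ X
    · obtain ⟨p, hpc, hmp⟩ := hp
      have hsub : insert p Q₀ ⊆ insert p Q₀ ∪ (insert p Q₀).image m := Finset.subset_union_left
      have hcard := card_union_image_le m (insert p Q₀)
      have hins := Finset.card_insert_le p Q₀
      have hcl := h.partner_mem_union_image (insert p Q₀)
      refine ⟨insert p Q₀ ∪ (insert p Q₀).image m, (Finset.subset_insert _ _).trans hsub, hcl,
        ⟨p, hpc, hsub (Finset.mem_insert_self _ _)⟩, ?_⟩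
      refine (h.exists_contractedMatching_or_two_fullCuts hfull hcl (by omega)).resolve_right ?_
      rintro ⟨_, K, L, hKL, hK, hL, hsK, hsL, hqK, hqL⟩
      -- A full cut inside `X` is a cut around `c`, so it equals `X` by minimality; but then the
      -- forbidden edge at `p` does not leave it.
      have hone : ∀ K : Finset V, IsFullCut F m K →
          (∀ q ∈ insert p Q₀ ∪ (insert p Q₀).image m, q ∈ K → m q ∉ K) → ¬ K ⊆ X := by
        intro K hK hqK hKX
        have hlt := (odd_card_iff_odd_card_oddComps hK.1).1 hK.2.1
        obtain ⟨d, hd⟩ := Finset.card_pos.1 hlt.pos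
        rw [Finset.mem_filter] at hd
        have hdc := (hX.2.2 d hd.1).1 (hd.2.trans hKX)
        subst hdc
        have hcut : IsCutAround F m d K := ⟨hK.1, hK.2.2, fun e he =>
          ⟨fun heK => (hX.2.2 e he).1 (heK.trans hKX), fun hed => hed ▸ hd.2⟩⟩
        have hKeq := hmin K hcut hKX
        subst hKeq
        exact hqK p (hsub (Finset.mem_insert_self _ _)) (hcX hpc) hmp
      -- The outside of `X` is a single class, so a saturated set that reaches it contains all of
      -- it; two disjoint sets cannot both do so.
      have hmeet : ∀ K : Finset V, (∀ v w, r v w → v ∈ K → w ∈ K) → ¬ K ⊆ X → m u ∈ K := by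
        intro K hsK hKX
        obtain ⟨v, hv, hvX⟩ := Finset.not_subset.1 hKX
        exact hsK v _ (Or.inr ⟨hvX, hmu⟩) hv
      exact Finset.disjoint_left.1 hKL (hmeet K hsK (hone K hK hqK))
        (hmeet L hsL (hone L hL hqL))
    · push Not at hp
      have hcl := h.partner_mem_union_image Q₀
      have hcard := card_union_image_le m Q₀
      -- Here every partner edge at `c` leaves `X`, so one of them other than that at `u` is already
      -- forbidden.
      obtain ⟨p, hpc, hpu⟩ := h.exists_ne_mem_compVerts c u
      refine ⟨Q₀ ∪ Q₀.image m, Finset.subset_union_left, hcl, ⟨p, hpc, Finset.mem_union_left _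
        (Finset.mem_erase.2 ⟨hpu, mem_leavingVerts.2 ⟨hcX hpc, hp p hpc⟩⟩)⟩,
        h.exists_contractedMatching_of_card_lt hfull hcl (by omega)⟩
  obtain ⟨Q, hQ₀Q, hQm, ⟨p, hpc, hpQ⟩, N, hN⟩ := key
  have hinX : ∀ x ∈ X, ∃! w, N x w := by
    intro x hx
    obtain ⟨⟨y, w⟩, ⟨hxy, hyw⟩, huniq⟩ := hN.unique x
    obtain rfl : x = y := hxy.elim id fun h' => absurd hx h'.1
    exact ⟨w, hyw, fun z hz => congrArg Prod.snd (huniq (x, z) ⟨Or.inl rfl, hz⟩)⟩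
  have hleave : ∀ x ∈ X, ∀ w ∉ X, N x w → x = u ∧ w = m u := by
    intro x hx w hw hxw
    rcases hN.allowed x w hxw with hF | ⟨rfl, hxQ⟩
    · exact absurd (leavingDarts_eq_empty.1 hX.1 x hx w hF) hw
    · by_cases hxu : x = u
      · exact ⟨hxu, hxu ▸ rfl⟩
      · exact absurd (hQ₀Q (Finset.mem_erase.2 ⟨hxu, mem_leavingVerts.2 ⟨hx, hw⟩⟩)) hxQ
  have hNu : N u (m u) := by
    obtain ⟨⟨y, w⟩, ⟨hy, hyw⟩, _⟩ := hN.unique (m u)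
    have hyX : y ∉ X := Or.elim hy (fun h' => by
      change m u = y at h'
      rwa [← h']) And.right
    have hwX : w ∈ X := by
      by_contra hw
      exact hN.crossing _ _ hyw (Or.inr ⟨hyX, hw⟩)
    have hwy := hN.symm _ _ hyw
    obtain ⟨rfl, rfl⟩ := hleave w hwX y hyX hwy
    exact hwy
  choose! n hn hnu using hinX
  simp only at hn hnu
  refine ⟨n, (hnu u hu _ hNu).symm, ?_, ?_, p, hpc, ?_⟩
  · intro x hx hxu
    have hnx : n x ∈ X := by
      by_contra hnx
      exact hxu (hleave x hx _ hnx (hn x hx)).1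
    exact ⟨hnx, (hnu _ hnx x (hN.symm _ _ (hn x hx))).symm⟩
  · intro x hx
    exact (h.adj_iff _ _).2 ((hN.allowed _ _ (hn x hx)).imp id And.left)
  · intro hnp
    have := hn p (hcX hpc)
    rw [hnp] at this
    rcases hN.allowed _ _ this with hF | ⟨_, hQ'⟩
    · exact h.not_adj p hF
    · exact hQ' hpQ

/-- A matching of the contraction of disjoint cuts extends to a matching of the whole graph. -/
lemma exists_matching_of_contracted (h4 : (oddComps F).card = 4)
    {I : Finset F.ConnectedComponent} (hI : I ⊆ oddComps F) {X : F.ConnectedComponent → Finset V}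
    (hX : ∀ c ∈ I, IsCutAround F m c (X c))
    (hmin : ∀ c ∈ I, ∀ Y, IsCutAround F m c Y → Y ⊆ X c → Y = X c)
    (hdis : ∀ c ∈ I, ∀ d ∈ I, ∀ v, v ∈ X c → v ∈ X d → c = d) (r : Setoid V)
    (hr : ∀ v w, r v w ↔ v = w ∨ ∃ c ∈ I, v ∈ X c ∧ w ∈ X c) {Q : Finset V}
    {N : V → V → Prop} (hN : IsContractedMatching F m r Q N) :
    ∃ n : V → V, (∀ v, n (n v) = v) ∧ (∀ v, G.Adj v (n v)) ∧
      (∀ c ∈ I, ∃ p ∈ compVerts F c, n p ≠ m p) ∧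
      ∀ p ∈ Q, (∀ c ∈ I, p ∉ X c) → n p ≠ m p := by
  -- The contracted cut is matched by a single edge, which is a partner edge because no `F`-edge
  -- leaves `X c`.
  have hroot : ∀ c ∈ I, ∃ u ∈ X c, m u ∉ X c ∧ N u (m u) ∧
      ∀ x ∈ X c, ∀ w, N x w → x = u ∧ w = m u := by
    intro c hc
    obtain ⟨v, hv⟩ := Finset.card_pos.1 ((hX c hc).odd_card (hI hc)).pos
    obtain ⟨⟨u, w⟩, ⟨hvu, huw⟩, huniq⟩ := hN.unique v
    have hu : u ∈ X c := by
      rcases (hr _ _).1 hvu with rfl | ⟨d, hd, hvd, hud⟩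
      · exact hv
      · rwa [hdis c hc d hd v hv hvd]
    have hw : w ∉ X c := fun hw => hN.crossing _ _ huw ((hr _ _).2 (Or.inr ⟨c, hc, hu, hw⟩))
    obtain rfl : w = m u := by
      rcases hN.allowed _ _ huw with hF | hF
      · exact absurd (leavingDarts_eq_empty.1 (hX c hc).1 u hu w hF) hw
      · exact hF.1
    refine ⟨u, hu, hw, huw, fun x hx w hxw => ?_⟩
    have := huniq (x, w) ⟨(hr _ _).2 (Or.inr ⟨c, hc, hv, hx⟩), hxw⟩
    exact ⟨congrArg Prod.fst this, congrArg Prod.snd this⟩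
  have hV : Nonempty V := by
    obtain ⟨c, _⟩ := Finset.card_pos.1 (show 0 < (oddComps F).card by omega)
    exact (compVerts_nonempty F c).to_subtype.map Subtype.val
  choose! u hu hmu hNu huu using hroot
  have hinner := fun c (hc : c ∈ I) => h.exists_inner_matching (hI hc) (hX c hc) (hmin c hc)
    (hu c hc) (hmu c hc)
  choose! inner hin1 hin2 hin3 hin4 using hinner
  have hout : ∀ v, ∃ w, (∀ c ∈ I, v ∉ X c) → N v w ∧ ∀ z, N v z → z = w := by
    intro v
    obtain ⟨⟨y, w⟩, ⟨hvy, hyw⟩, huniq⟩ := hN.unique v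
    refine ⟨w, fun hv => ?_⟩
    obtain rfl : v = y := by
      rcases (hr _ _).1 hvy with rfl | ⟨d, hd, hvd, _⟩
      · rfl
      · exact absurd hvd (hv d hd)
    exact ⟨hyw, fun z hz => congrArg Prod.snd (huniq (v, z) ⟨r.refl _, hz⟩)⟩
  choose outer houter using hout
  have hndef : ∃ n : V → V, (∀ c ∈ I, ∀ v ∈ X c, n v = inner c v) ∧
      ∀ v, (∀ c ∈ I, v ∉ X c) → n v = outer v := by
    refine ⟨fun v => if hv : ∃ c ∈ I, v ∈ X c then inner hv.choose v else outer v, ?_, ?_⟩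
    · intro c hc v hv
      have hex : ∃ c ∈ I, v ∈ X c := ⟨c, hc, hv⟩
      simp only [dif_pos hex]
      rw [hdis _ hex.choose_spec.1 c hc v hex.choose_spec.2 hv]
    · intro v hv
      have hex : ¬ ∃ c ∈ I, v ∈ X c := fun ⟨c, hc, hv'⟩ => hv c hc hv'
      simp only [dif_neg hex]
  obtain ⟨n, hn1, hn2⟩ := hndef
  have hnN : ∀ v w, N v w → n v = w := by
    intro v w hvw
    by_cases hv : ∃ c ∈ I, v ∈ X c
    · obtain ⟨c, hc, hv⟩ := hv
      obtain ⟨rfl, rfl⟩ := huu c hc v hv w hvw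
      rw [hn1 c hc _ hv, hin1 c hc]
    · push Not at hv
      rw [hn2 v hv]
      exact ((houter v hv).2 w hvw).symm
  refine ⟨n, ?_, ?_, ?_, ?_⟩
  · intro v
    by_cases hv : ∃ c ∈ I, v ∈ X c
    · obtain ⟨c, hc, hv⟩ := hv
      by_cases hvu : v = u c
      · subst hvu
        rw [hnN _ _ (hNu c hc), hnN _ _ (hN.symm _ _ (hNu c hc))]
      · obtain ⟨h1, h2⟩ := hin2 c hc v hv hvu
        rw [hn1 c hc v hv, hn1 c hc _ h1, h2]
    · push Not at hv
      have h1 := (houter v hv).1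
      rw [hnN _ _ h1, hnN _ _ (hN.symm _ _ h1)]
  · intro v
    by_cases hv : ∃ c ∈ I, v ∈ X c
    · obtain ⟨c, hc, hv⟩ := hv
      rw [hn1 c hc v hv]
      exact hin3 c hc v hv
    · push Not at hv
      rw [hn2 v hv, h.adj_iff]
      exact (hN.allowed _ _ (houter v hv).1).imp id And.left
  · intro c hc
    obtain ⟨p, hp, hne⟩ := hin4 c hc
    exact ⟨p, hp, by rwa [hn1 c hc p ((hX c hc).compVerts_subset (hI hc) hp)]⟩
  · intro p hp hpX hnp
    have h1 := (houter p hpX).1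
    rw [← hn2 p hpX, hnp] at h1
    rcases hN.allowed _ _ h1 with hF | hF
    · exact h.not_adj p hF
    · exact hF.2 hp

/-! ### Choice of the forbidden edges -/

/-- If the odd component `c` is the only one with a cut around it, then the other odd components
have partner edges that do not all lie on one cut around `c`. -/
lemma exists_transversal_avoiding_cuts (h4 : (oddComps F).card = 4) {c : F.ConnectedComponent}
    (hc : c ∈ oddComps F) :
    ∃ p : F.ConnectedComponent → V, (∀ d, p d ∈ compVerts F d) ∧
      ∀ Y, IsCutAround F m c Y → ∃ d ∈ oddComps F, d ≠ c ∧ m (p d) ∉ Y := by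
  choose p₀ hp₀ using compVerts_nonempty F
  by_cases hex : ∃ Y, IsCutAround F m c Y
  swap
  · exact ⟨p₀, hp₀, fun Y hY => absurd ⟨Y, hY⟩ hex⟩
  obtain ⟨Y₀, hY₀⟩ := hex
  -- Cuts around `c` are closed under union, so a largest one contains all the others, and a partner
  -- outside it lies outside every cut.
  obtain ⟨Y, hY, hmax⟩ := Finset.exists_max_image
    (Finset.univ.filter fun Y : Finset V => IsCutAround F m c Y) Finset.card
    ⟨Y₀, by simpa using hY₀⟩
  simp only [Finset.mem_filter, Finset.mem_univ, true_and] at hY hmax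
  have hsub : ∀ Z, IsCutAround F m c Z → Z ⊆ Y := by
    intro Z hZ
    have h1 := hmax _ (h.isCutAround_inter_union hc hY hZ).2
    have h2 := Finset.eq_of_subset_of_card_le (Finset.subset_union_left (s₁ := Y) (s₂ := Z)) h1
    rw [h2]
    exact Finset.subset_union_right
  -- Otherwise two other odd components, with at least two vertices each, would send all their
  -- partner edges across a cut of size three.
  have hgood : ∃ d ∈ oddComps F, d ≠ c ∧ ∃ q ∈ compVerts F d, m q ∉ Y := by
    by_contra! hno
    obtain ⟨d, hd, e, he, hde⟩ := Finset.one_lt_card.1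
      (show 1 < ((oddComps F).erase c).card by rw [Finset.card_erase_of_mem hc, h4]; norm_num)
    rw [Finset.mem_erase] at hd he
    have hle : ∀ d ∈ oddComps F, d ≠ c → compVerts F d ⊆ leavingVerts m Yᶜ := by
      intro d hd hdc q hq
      have : compVerts F d ⊆ Yᶜ := (compVerts_subset_compl hY.1 d).2 fun h' =>
        hdc ((hY.2.2 d hd).1 h')
      rw [mem_leavingVerts, Finset.mem_compl (a := m q), not_not]
      exact ⟨this hq, hno d hd hdc q hq⟩
    have h1 := Finset.card_le_card (Finset.union_subset (hle d hd.2 hd.1) (hle e he.2 he.1))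
    rw [h.card_leavingVerts_compl, hY.2.1, Finset.card_union_of_disjoint] at h1
    · have h2 := h.two_le_card_compVerts d
      have h3 := h.two_le_card_compVerts e
      omega
    · refine Finset.disjoint_left.2 fun v hv hv' => hde ?_
      rw [← mem_compVerts.1 hv, ← mem_compVerts.1 hv']
  obtain ⟨d, hd, hdc, q, hq, hqY⟩ := hgood
  refine ⟨Function.update p₀ d q, ?_, fun Z hZ => ⟨d, hd, hdc, ?_⟩⟩
  · intro e
    by_cases hed : e = d
    · subst hed; simpa using hq
    · rw [Function.update_of_ne hed]; exact hp₀ e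
  · rw [Function.update_self]
    exact fun hqZ => hqY (hsub Z hZ hqZ)

/-- If `F` has four odd components, then some perfect matching of `G` misses, at each of them, one
of the partner edges. -/
lemma exists_matching (h4 : (oddComps F).card = 4) :
    ∃ n : V → V, (∀ v, n (n v) = v) ∧ (∀ v, G.Adj v (n v)) ∧
      ∀ c ∈ oddComps F, ∃ p ∈ compVerts F c, n p ≠ m p := by
  let I : Finset F.ConnectedComponent := (oddComps F).filter fun c => ∃ X, IsCutAround F m c X
  have hI : I ⊆ oddComps F := Finset.filter_subset _ _
  have hImem : ∀ c ∈ oddComps F, ∀ X, IsCutAround F m c X → c ∈ I := fun c hc X hX =>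
    Finset.mem_filter.2 ⟨hc, X, hX⟩
  have hmin : ∀ c ∈ I, ∃ X, IsCutAround F m c X ∧ ∀ Y, IsCutAround F m c Y → Y ⊆ X → Y = X := by
    intro c hc
    obtain ⟨X₀, hX₀⟩ := (Finset.mem_filter.1 hc).2
    obtain ⟨X, hX, hmin⟩ := Finset.exists_min_image
      (Finset.univ.filter fun Y : Finset V => IsCutAround F m c Y) Finset.card
      ⟨X₀, by simpa using hX₀⟩
    simp only [Finset.mem_filter, Finset.mem_univ, true_and] at hX hmin
    exact ⟨X, hX, fun Y hY hYX => Finset.eq_of_subset_of_card_le hYX (hmin Y hY)⟩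
  choose! X hX hXmin using hmin
  -- If two minimal cuts met, removing one from the other would give a smaller cut around the same
  -- component.
  have hdis : ∀ c ∈ I, ∀ d ∈ I, ∀ v, v ∈ X c → v ∈ X d → c = d := by
    intro c hc d hd v hvc hvd
    by_contra hne
    have h1 := hXmin c hc _ (h.isCutAround_sdiff (hI hc) (hI hd) hne (hX c hc) (hX d hd))
      Finset.inter_subset_left
    rw [← h1] at hvc
    exact Finset.mem_compl.1 (Finset.mem_inter.1 hvc).2 hvd
  let r : Setoid V :=
    { r := fun v w => v = w ∨ ∃ c ∈ I, v ∈ X c ∧ w ∈ X c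
      iseqv := ⟨fun _ => Or.inl rfl,
        fun h => h.imp Eq.symm fun ⟨c, hc, h1, h2⟩ => ⟨c, hc, h2, h1⟩, by
        rintro x y z (rfl | ⟨c, hc, h1, h2⟩) (rfl | ⟨d, hd, h3, h4⟩)
        · exact Or.inl rfl
        · exact Or.inr ⟨d, hd, h3, h4⟩
        · exact Or.inr ⟨c, hc, h1, h2⟩
        · obtain rfl := hdis c hc d hd y h2 h3
          exact Or.inr ⟨c, hc, h1, h4⟩⟩ }
  have hr : ∀ v w, r v w ↔ v = w ∨ ∃ c ∈ I, v ∈ X c ∧ w ∈ X c := fun _ _ => Iff.rfl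
  have hfull : HasFullClasses F m r := by
    intro v
    by_cases hv : ∃ c ∈ I, v ∈ X c
    · obtain ⟨c, hc, hv⟩ := hv
      right
      have : Finset.univ.filter (r v) = X c := by
        ext w
        simp only [Finset.mem_filter, Finset.mem_univ, true_and, hr]
        constructor
        · rintro (rfl | ⟨d, hd, hvd, hw⟩)
          · exact hv
          · rwa [hdis c hc d hd v hv hvd]
        · exact fun hw => Or.inr ⟨c, hc, hv, hw⟩
      rw [this]
      exact (hX c hc).isFullCut (hI hc)
    · left
      ext w
      simp only [Finset.mem_filter, Finset.mem_univ, true_and, hr, Finset.mem_singleton]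
      exact ⟨fun h' => h'.elim Eq.symm fun ⟨c, hc, hvc, _⟩ => absurd ⟨c, hc, hvc⟩ hv,
        fun h' => Or.inl h'.symm⟩
  have key : ∃ (p : F.ConnectedComponent → V) (Q : Finset V), (∀ c, p c ∈ compVerts F c) ∧
      (∀ c ∈ oddComps F, c ∉ I → p c ∈ Q) ∧ ∃ N, IsContractedMatching F m r Q N := by
    have hQ : ∀ p : F.ConnectedComponent → V,
        ((oddComps F \ I).image p ∪ ((oddComps F \ I).image p).image m).card ≤
          2 * (4 - I.card) := by
      intro p
      have h1 := card_union_image_le m ((oddComps F \ I).image p)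
      have h2 := Finset.card_image_le (s := oddComps F \ I) (f := p)
      rw [Finset.card_sdiff_of_subset hI, h4] at h2
      omega
    have hpQ : ∀ (p : F.ConnectedComponent → V), ∀ c ∈ oddComps F, c ∉ I →
        p c ∈ (oddComps F \ I).image p ∪ ((oddComps F \ I).image p).image m :=
      fun p c hc hcI => Finset.mem_union_left _
        (Finset.mem_image_of_mem _ (Finset.mem_sdiff.2 ⟨hc, hcI⟩))
    have hcl := fun p : F.ConnectedComponent → V =>
      h.partner_mem_union_image ((oddComps F \ I).image p)
    rcases Nat.lt_or_ge 1 I.card with h2 | h2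
    · choose p hp using compVerts_nonempty F
      have := hQ p
      exact ⟨p, _, hp, hpQ p, h.exists_contractedMatching_of_card_lt hfull (hcl p) (by omega)⟩
    rcases Nat.eq_zero_or_pos I.card with h0 | h0
    · choose p hp using compVerts_nonempty F
      have := hQ p
      refine ⟨p, _, hp, hpQ p, (h.exists_contractedMatching_or_fullCut hfull (hcl p)
        (by omega)).resolve_right ?_⟩
      rintro ⟨K, hK⟩
      obtain ⟨c, hc, hcK⟩ := h.exists_isCutAround_of_isFullCut h4 hK
      rw [Finset.card_eq_zero] at h0
      have : c ∈ I := hcK.elim (hImem c hc _) (hImem c hc _)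
      rw [h0] at this
      simp at this
    · obtain ⟨c, hIc⟩ := Finset.card_eq_one.1 (show I.card = 1 by omega)
      have hcI : c ∈ I := hIc ▸ Finset.mem_singleton_self c
      have hc := hI hcI
      obtain ⟨p, hp, hpY⟩ := h.exists_transversal_avoiding_cuts h4 hc
      have := hQ p
      refine ⟨p, _, hp, hpQ p, (h.exists_contractedMatching_or_two_fullCuts hfull (hcl p)
        (by omega)).resolve_right ?_⟩
      rintro ⟨_, K, L, hKL, hK, hL, _, _, hqK, hqL⟩
      have hor : ∀ K, IsFullCut F m K → IsCutAround F m c K ∨ IsCutAround F m c Kᶜ := by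
        intro K hK
        obtain ⟨d, hd, hdK⟩ := h.exists_isCutAround_of_isFullCut h4 hK
        have hdI : d ∈ I := hdK.elim (hImem d hd _) (hImem d hd _)
        rw [hIc, Finset.mem_singleton] at hdI
        rwa [hdI] at hdK
      -- If `Kᶜ` were a cut around `c`, the transversal would supply a forbidden edge with both ends
      -- in `K`. Hence both `K` and `L` are cuts around `c`, although they are disjoint.
      have hbad : ∀ K, IsFullCut F m K → (∀ q ∈ (oddComps F \ I).image p ∪
          ((oddComps F \ I).image p).image m, q ∈ K → m q ∉ K) → ¬ IsCutAround F m c Kᶜ := by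
        intro K hK hqK hcut
        obtain ⟨d, hd, hdc, hmd⟩ := hpY _ hcut
        rw [Finset.mem_compl, not_not] at hmd
        have hdI : d ∉ I := by rwa [hIc, Finset.mem_singleton]
        have hdK : p d ∈ K := by
          have h1 : ¬ compVerts F d ⊆ Kᶜ := fun h' => hdc ((hcut.2.2 d hd).1 h')
          rw [compVerts_subset_compl hK.1, not_not] at h1
          exact h1 (hp d)
        exact hqK _ (hpQ p d hd hdI) hdK hmd
      have hK' := (hor K hK).resolve_right (hbad K hK hqK)
      have hL' := (hor L hL).resolve_right (hbad L hL hqL)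
      obtain ⟨v, hv⟩ := compVerts_nonempty F c
      exact Finset.disjoint_left.1 hKL (hK'.compVerts_subset hc hv) (hL'.compVerts_subset hc hv)
  obtain ⟨p, Q, hp, hpQ, N, hN⟩ := key
  obtain ⟨n, hn1, hn2, hn3, hn4⟩ := h.exists_matching_of_contracted h4 hI hX hXmin hdis r hr hN
  refine ⟨n, hn1, hn2, fun c hc => ?_⟩
  by_cases hcI : c ∈ I
  · exact hn3 c hcI
  · refine ⟨p c, hp c, hn4 _ (hpQ c hc hcI) fun d hd hpd => hcI ?_⟩
    have h1 := compVerts_subset (hX d hd).1 hpd (hp c)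
    rwa [((hX d hd).2.2 c hc).1 h1]

end IsFactorPair
end PartnerCuts
end SimpleGraph

/-! ### From the matching to bipartiteness -/

namespace SimpleGraph

/-- A graph without odd cycles is bipartite. -/
lemma isBipartite_of_forall_isCycle_even {V : Type*} {H : SimpleGraph V}
    (hH : ∀ (u : V) (p : H.Walk u u), p.IsCycle → Even p.length) : H.IsBipartite := by
  classical
  -- Each loop cut off by `bypass` is a cycle or an edge traversed back and forth, so its length is
  -- even.
  have key : ∀ (u v : V) (p : H.Walk u v), Even p.length ↔ Even p.bypass.length := by
    intro u v p
    induction p with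
    | nil => simp [Walk.bypass]
    | @cons u v w huv p ih =>
      simp only [Walk.bypass]
      split_ifs with hs
      · have hp := p.bypass_isPath.takeUntil hs
        have hlen : (p.bypass.takeUntil u hs).length + (p.bypass.dropUntil u hs).length
            = p.bypass.length := by
          rw [← Walk.length_append, Walk.take_spec]
        have heven : Even ((p.bypass.takeUntil u hs).length + 1) := by
          by_cases hmem : s(u, v) ∈ (p.bypass.takeUntil u hs).edges
          · rw [hp.length_eq_one_of_mem_edges (Sym2.eq_swap ▸ hmem)]
            decide
          · exact hH u _ ((Walk.cons_isCycle_iff _ huv).2 ⟨hp, hmem⟩)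
        rw [Walk.length_cons, Nat.even_add_one, ih, ← hlen]
        rw [Nat.even_add_one] at heven
        rw [Nat.even_add]
        tauto
      · rw [Walk.length_cons, Walk.length_cons, Nat.even_add_one, Nat.even_add_one, ih]
  refine two_colorable_iff_forall_loop_even.2 fun u p => ?_
  rw [key, (Walk.isPath_iff_nil.1 p.bypass_isPath).eq_nil]
  simp

section PartnerCuts
open scoped Classical
variable {V : Type*}

/-- The perfect matching given by an involution along edges. -/
def subgraphOfInvolution {G : SimpleGraph V} (n : V → V) (hn : ∀ v, n (n v) = v)
    (hadj : ∀ v, G.Adj v (n v)) : G.Subgraph where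
  verts := Set.univ
  Adj v w := w = n v
  adj_sub := by rintro v w rfl; exact hadj v
  edge_vert _ := Set.mem_univ _
  symm := ⟨by rintro v w rfl; exact (hn v).symm⟩

lemma isPerfectMatching_subgraphOfInvolution {G : SimpleGraph V} (n : V → V)
    (hn : ∀ v, n (n v) = v) (hadj : ∀ v, G.Adj v (n v)) :
    (subgraphOfInvolution n hn hadj).IsPerfectMatching :=
  ⟨fun v _ => ⟨n v, rfl, fun _ h => h⟩, fun v => Set.mem_univ v⟩

variable [Fintype V]

/-- A subgraph of a 2-regular graph missing an edge at every odd component is bipartite. -/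
lemma isBipartite_of_forall_oddComps {F H : SimpleGraph V} (hHF : H ≤ F)
    (htwo : ∀ v, (F.neighborSet v).ncard = 2)
    (hmiss : ∀ c ∈ oddComps F, ∃ v ∈ compVerts F c, ∃ w, F.Adj v w ∧ ¬ H.Adj v w) :
    H.IsBipartite := by
  refine isBipartite_of_forall_isCycle_even fun u p hp => ?_
  by_contra hodd
  rw [Nat.not_even_iff_odd] at hodd
  have hp' : (p.mapLe hHF).IsCycle := hp.mapLe hHF
  have hcyc : F.IsCycles := fun v _ => htwo v
  -- As `F` is 2-regular, a cycle of `H` uses all `F`-edges at its vertices; it is thus a whole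
  -- component of `F`, none of whose edges is missing.
  have hadj : ∀ v ∈ p.support, ∀ w, F.Adj v w → s(v, w) ∈ p.edges := by
    intro v hv w hvw
    have h1 : v ∈ (p.mapLe hHF).toSubgraph.verts := by simpa using hv
    have h2 := (hp'.adj_toSubgraph_iff_of_isCycles hcyc h1 w).2 hvw
    rw [← Subgraph.mem_edgeSet, Walk.mem_edges_toSubgraph] at h2
    simpa using h2
  have hclosed : leavingDarts F p.support.toFinset = ∅ := by
    rw [leavingDarts_eq_empty]
    intro v hv w hvw
    rw [List.mem_toFinset] at *
    exact p.snd_mem_support_of_mem_edges (hadj v hv w hvw)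
  have hsupp : p.support.toFinset = compVerts F (F.connectedComponentMk u) := by
    refine Finset.Subset.antisymm (fun v hv => ?_) (compVerts_subset hclosed (v := u) (by simp)
      (by simp))
    rw [List.mem_toFinset] at hv
    rw [mem_compVerts]
    exact (ConnectedComponent.sound ((p.takeUntil v hv).mapLe hHF).reachable).symm
  have hcard : p.support.toFinset.card = p.length := by
    have h1 : p.support.toFinset = p.support.tail.toFinset := by
      ext v
      simp only [List.mem_toFinset]
      refine ⟨fun hv => ?_, List.mem_of_mem_tail⟩
      rw [p.mem_support_iff] at hv
      rcases hv with rfl | hv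
      · exact Walk.end_mem_tail_support hp.not_nil
      · exact hv
    rw [h1, List.toFinset_card_of_nodup hp.support_nodup, List.length_tail, Walk.length_support]
    simp
  rw [← hcard, hsupp] at hodd
  obtain ⟨v, hv, w, hvw, hvw'⟩ := hmiss _ (mem_oddComps.2 hodd)
  rw [← hsupp, List.mem_toFinset] at hv
  exact hvw' (p.adj_of_mem_edges (hadj v hv w hvw))

/-- A spanning 2-regular subgraph of a cubic graph determines the partner involution. -/
lemma IsTwoFactor.exists_partner {G F : SimpleGraph V} (hF : G.IsTwoFactor F)
    (hcubic : ∀ v, (G.neighborSet v).ncard = 3) (hbridge : G.IsBridgeless) :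
    ∃ m, IsFactorPair G F m := by
  have hsub : ∀ v, F.neighborSet v ⊆ G.neighborSet v := fun v w hvw => hF.1 hvw
  have hex : ∀ v, ∃ w, G.neighborSet v \ F.neighborSet v = {w} := by
    intro v
    rw [← Set.ncard_eq_one, Set.ncard_sdiff (hsub v), hcubic, hF.2]
  choose m hm using hex
  have hmem : ∀ v w, (G.Adj v w ∧ ¬ F.Adj v w) ↔ w = m v := fun v w => by
    rw [← Set.mem_singleton_iff, ← hm]
    rfl
  refine ⟨m, ?_, ?_, ?_, ?_, hbridge⟩
  · intro v
    have := (hmem v _).2 rfl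
    exact ((hmem (m v) v).1 ⟨this.1.symm, fun h => this.2 h.symm⟩).symm
  · intro v w
    rw [← hmem]
    have := @hF.1 v w
    tauto
  · exact fun v => ((hmem v _).2 rfl).2
  · intro v
    rw [← hF.2 v, ← Set.ncard_coe_finset]
    congr 1
    ext w
    simp

end PartnerCuts
end SimpleGraph

theorem mainTheorem2 {V : Type*} [Fintype V] (G : SimpleGraph V) [DecidableRel G.Adj]
    (hconn : G.Connected) (hcubic : G.IsRegularOfDegree 3) (hbridge : G.IsBridgeless)
    (hodd : G.oddness = 4) :
    ∃ M₁ M₂ : G.Subgraph, G.IsS4Pair M₁ M₂ := by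
  -- `sInf ∅ = 0`, so a positive oddness guarantees a 2-factor attaining it.
  have hne : {n : ℕ | ∃ F : SimpleGraph V, G.IsTwoFactor F ∧ F.oddComponents.ncard = n}.Nonempty :=
    Nat.nonempty_of_pos_sInf (by
      change 0 < G.oddness
      omega)
  obtain ⟨F, hF, hF4⟩ := Nat.sInf_mem hne
  change F.oddComponents.ncard = G.oddness at hF4
  have hcub : ∀ v, (G.neighborSet v).ncard = 3 := fun v => by
    rw [← hcubic v, ← SimpleGraph.card_neighborSet_eq_degree, ← Nat.card_coe_set_eq,
      Nat.card_eq_fintype_card]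
  obtain ⟨m, h⟩ := hF.exists_partner hcub hbridge
  have h4 : (SimpleGraph.oddComps F).card = 4 := by
    rw [← hodd, ← hF4, ← Set.ncard_coe_finset]
    congr 1
    ext c
    rw [Finset.mem_coe, SimpleGraph.mem_oddComps, ← Set.ncard_coe_finset]
    have : (SimpleGraph.compVerts F c : Set V) = c.supp := by ext; simp
    rw [this]
    rfl
  obtain ⟨n, hn, hadj, hmiss⟩ := h.exists_matching h4
  refine ⟨SimpleGraph.subgraphOfInvolution m h.invol h.adj_partner,
    SimpleGraph.subgraphOfInvolution n hn hadj,
    SimpleGraph.isPerfectMatching_subgraphOfInvolution _ _ _,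
    SimpleGraph.isPerfectMatching_subgraphOfInvolution _ _ _,
    SimpleGraph.isBipartite_of_forall_oddComps (F := F) ?_ hF.2 fun c hc => ?_⟩
  · intro v w hvw
    rw [SimpleGraph.deleteEdges_adj, h.adj_iff] at hvw
    exact hvw.1.resolve_right fun hw => hvw.2 (Or.inl hw)
  · obtain ⟨p, hp, hne⟩ := hmiss c hc
    refine ⟨p, hp, n p, ((h.adj_iff _ _).1 (hadj p)).resolve_right hne, fun hdel => ?_⟩
    rw [SimpleGraph.deleteEdges_adj] at hdel
    exact hdel.2 (Or.inr (show n p = n p from rfl))
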